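/- Consider $N \ge 1$ files $\{1,\dots,N\}$ of $F$ bits each and $K$ users, each with a cache of $\lfloor MF\rfloor$ bits, where $M \ge 0$ is real. The file contents are independent and uniformly distributed. In the placement phase each user stores an arbitrary function of all the files in its cache. In the delivery phase the users request files independently, each user requesting file $n$ with probability $p_n$, where $p_1 \ge p_2 \ge \dots \ge p_N > 0$ and $\sum_n p_n = 1$. Knowing the request vector $\underline d$, the server sends a message (an arbitrary function of the files) whose number of bits may depend on $\underline d$, and each user estimates its requested file from $\underline d$, the message and its cache. The expected rate is the expected number of transmitted bits divided by $F$. A pair $(R,M)$ is achievable if for every $\varepsilon>0$ and all sufficiently large $F$ there is such a scheme with expected rate at most $R$ in which, for every request vector, each user's probability of error is at most $\varepsilon$. Let $R^\star(M,\mathcal N,K)$ be the infimum of all $R$ such that $(R,M)$ is achievable. For integers $N\ge 1$ and $K \ge 1$ let $$R(M,N,K) = K(1-M/N)\min\Bigl\{\frac{N}{KM}\bigl(1-(1-M/N)^K\bigr),\frac NK\Bigr\}\quad\text{for } 0<M\le N,$$ $R(0,N,K)=\min\{N,K\}$ and $R(M,N,K)=0$ for $M>N$; also let $R(M,N,0)=0$.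 Let $\mathcal N_1,\dots,\mathcal N_L$, of sizes $N_1,\dots,N_L$, be the maximal partition of the files to within popularity factor two: the groups are nonempty sets of consecutive files, $\mathcal N_1$ first, and if $n$ is the first file of $\mathcal N_\ell$, then every file in $\mathcal N_\ell$ has popularity at least $p_n/2$ and every file after $\mathcal N_\ell$ has popularity less than $p_n/2$. Let $\mathsf K_\ell$ be the (random) number of users that request a file in $\mathcal N_\ell$. Then $$R^\star(M,\mathcal N,K) \;\ge\; \frac{1}{cL}\sum_{\ell=1}^L \mathbb E\bigl(R(M,N_\ell,\mathsf K_\ell)\bigr)$$ with the universal constant $c = 72\cdot 12$. -/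

import Mathlib

namespace CodedCaching

/-- A library of `N` files, each of `F` bits. -/
abbrev Files (N F : ℕ) : Type := Fin N → Fin F → Bool

/-- A vector of requests: user `k` requests file `d k`. -/
abbrev Demand (N K : ℕ) : Type := Fin K → Fin N

/-- A caching scheme for `N` files of `F` bits and `K` users, each with a cache of `C` bits.
* Placement: user `k` stores `C` bits, an arbitrary function of all the files, chosen before the
  requests are known.
* Delivery: once the request vector `d` is known, the server sends `len d` bits over the shared
  link, an arbitrary function of all the files.
* Decoding: user `k` forms an estimate of its requested file from `d`, the transmitted message and
  its own cache content. -/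
structure Scheme (N K F C : ℕ) where
  cache : Fin K → Files N F → (Fin C → Bool)
  len : Demand N K → ℕ
  encode : (d : Demand N K) → Files N F → (Fin (len d) → Bool)
  decode : (d : Demand N K) → Fin K → (Fin (len d) → Bool) → (Fin C → Bool) → (Fin F → Bool)

/-- The probability, for independent uniformly distributed files, that user `k` does not recover
its requested file when the request vector is `d`. -/
noncomputable def Scheme.errorProb {N K F C : ℕ} (S : Scheme N K F C)
    (d : Demand N K) (k : Fin K) : ℝ :=
  ((Finset.univ.filter fun W : Files N F =>
      S.decode d k (S.encode d W) (S.cache k W) ≠ W (d k)).card : ℝ)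
    / (Fintype.card (Files N F) : ℝ)

/-- Expectation of `f d` when the `K` users request files independently of each other, each of them
requesting file `n` with probability `p n`. -/
noncomputable def expect {N K : ℕ} (p : Fin N → ℝ) (f : Demand N K → ℝ) : ℝ :=
  ∑ d : Demand N K, (∏ k : Fin K, p (d k)) * f d

/-- The expected load of the shared link, normalized by the file size. -/
noncomputable def Scheme.expectedRate {N K F C : ℕ} (S : Scheme N K F C) (p : Fin N → ℝ) : ℝ :=
  expect p fun d => (S.len d : ℝ) / (F : ℝ)

/-- The rate-memory pair `(R, M)` is achievable for popularities `p` and `K` users: for every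
`ε > 0` and every large enough file size `F` there is a scheme with caches of `⌊M F⌋` bits, with
probability of error at most `ε` for all requests and users, and with expected rate at most `R`. -/
def IsAchievable {N : ℕ} (p : Fin N → ℝ) (K : ℕ) (M R : ℝ) : Prop :=
  ∀ ε : ℝ, 0 < ε → ∀ᶠ F : ℕ in Filter.atTop,
    ∃ S : Scheme N K F ⌊M * (F : ℝ)⌋₊,
      (∀ (d : Demand N K) (k : Fin K), S.errorProb d k ≤ ε) ∧ S.expectedRate p ≤ R

/-- The optimal expected rate for normalized cache size `M`, popularities `p` and `K` users. -/
noncomputable def optimalRate {N : ℕ} (M : ℝ) (p : Fin N → ℝ) (K : ℕ) : ℝ :=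
  sInf {R : ℝ | IsAchievable p K M R}

/-- The peak rate `R(M, N, K)` of the decentralized coded caching scheme, for `0 ≤ M`.
(For `K = 0` it is `0`.) -/
noncomputable def peakRate (M : ℝ) (N K : ℕ) : ℝ :=
  if M = 0 then min (N : ℝ) (K : ℝ)
  else if M ≤ (N : ℝ) then
    (K : ℝ) * (1 - M / (N : ℝ)) *
      min ((N : ℝ) / ((K : ℝ) * M) * (1 - (1 - M / (N : ℝ)) ^ K)) ((N : ℝ) / (K : ℝ))
  else 0

/-- For popularities `p` listed in nonincreasing order, the map `g` sending each file to the index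
of its group describes the maximal partition of the files to within popularity factor two: the `L`
groups are nonempty sets of consecutive files and, if `n` is the first file of its group, then all
the files of this group have popularity at least `p n / 2` while all the files of the later groups
have popularity less than `p n / 2`. -/
structure IsMaximalPartition {N L : ℕ} (p : Fin N → ℝ) (g : Fin N → Fin L) : Prop where
  monotone : Monotone g
  surjective : Function.Surjective g
  half_le : ∀ n n' : Fin N, (∀ m : Fin N, g m = g n → n ≤ m) → g n' = g n → p n / 2 ≤ p n'
  lt_half : ∀ n n' : Fin N, (∀ m : Fin N, g m = g n → n ≤ m) → g n < g n' → p n' < p n / 2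

/-- The number `N_ℓ` of files in group `ℓ`. -/
def groupSize {N L : ℕ} (g : Fin N → Fin L) (l : Fin L) : ℕ :=
  (Finset.univ.filter fun n : Fin N => g n = l).card

/-- The number `K_ℓ` of users requesting a file in group `ℓ`, as a function of the requests. -/
def groupUsers {N L K : ℕ} (g : Fin N → Fin L) (l : Fin L) (d : Demand N K) : ℕ :=
  (Finset.univ.filter fun k : Fin K => g (d k) = l).card

end CodedCaching

namespace CodedCaching

/-! Fix one group `G` of `n` files and condition on the set `U` of users requesting in it. Requests
of users in `U` are then independent, and each file of `G` has conditional popularity at least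
`1/(2n)`. Two cut-set arguments, both from `Scheme.card_mul_le`, bound the conditional expected
length from below. If `6M ≤ n`, choose `s` users of `U` with `sM ≤ n/6` and draw about `n/s`
independent request vectors. These users request at least `n/3` distinct files on average, while
their caches hold at most `n/6` files' worth of bits, so a transmission averages at least `sF/12 -
1` bits; `s` can be taken at least a twelfth of the peak rate. If `6M > n`, a single user served
with every file of `G` in turn gives `(1 - M/n)F/2 - 1`, and the peak rate is at most `6(1 - M/n)`.
Summing over `U` and letting `F → ∞` yields `144 R ≥ E R(M, N_ℓ, K_ℓ)` for each group; averaging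
over the groups costs the factor `L`. -/

/-! ### Cut-set bound by counting -/

/-- If the error probabilities are at most `1 / (2 N)`, then the transmissions for the request
vectors `d j` together with the caches of the users in `T` carry, up to one bit, all the files that
the users in `T` request in some `d j`. -/
theorem Scheme.card_mul_le {N K F C : ℕ} (S : Scheme N K F C)
    (hS : ∀ d k, S.errorProb d k ≤ 1 / (2 * (N : ℝ))) {ι : Type*} [Fintype ι] [DecidableEq ι]
    (d : ι → Demand N K) (T : Finset (Fin K)) (A : Finset (Fin N))
    (hA : ∀ i ∈ A, ∃ j, ∃ t ∈ T, d j t = i) :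
    A.card * F ≤ ∑ j, S.len (d j) + T.card * C + 1 := by
  classical
  rcases A.eq_empty_or_nonempty with rfl | ⟨i₀, hi₀⟩
  · simp
  obtain ⟨j₀, t₀, -, -⟩ := hA i₀ hi₀
  have : Nonempty ι := ⟨j₀⟩
  have : Nonempty (Fin K) := ⟨t₀⟩
  choose! j t htT hdt using hA
  let bad (i : Fin N) : Finset (Files N F) := Finset.univ.filter fun W =>
    ¬ (i ∈ A → S.decode (d (j i)) (t i) (S.encode (d (j i)) W) (S.cache (t i) W) = W i)
  let good : Finset (Files N F) := Finset.univ.filter fun W => ∀ i ∈ A,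
    S.decode (d (j i)) (t i) (S.encode (d (j i)) W) (S.cache (t i) W) = W i
  have hfiles : (0 : ℝ) < Fintype.card (Files N F) := by exact_mod_cast Fintype.card_pos
  have hbad : ∀ i ∈ A, ((bad i).card : ℝ) ≤ Fintype.card (Files N F) / (2 * N) := by
    intro i hi
    have h := hS (d (j i)) (t i)
    rw [Scheme.errorProb, div_le_iff₀ hfiles] at h
    have hb : bad i = Finset.univ.filter fun W : Files N F =>
        S.decode (d (j i)) (t i) (S.encode (d (j i)) W) (S.cache (t i) W) ≠ W (d (j i) (t i)) := by
      ext W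
      simp only [bad, Finset.mem_filter, hi, true_imp_iff, Ne]
      rw [hdt i hi]
    rw [hb]
    calc _ ≤ _ := h
      _ = _ := by ring
  have hcover : (Finset.univ : Finset (Files N F)) ⊆ good ∪ A.biUnion bad := by
    intro W _
    by_cases hW : W ∈ good
    · exact Finset.mem_union_left _ hW
    · refine Finset.mem_union_right _ ?_
      simp only [good, Finset.mem_filter, Finset.mem_univ, true_and, not_forall] at hW
      obtain ⟨i, hi, hW⟩ := hW
      refine Finset.mem_biUnion.2 ⟨i, hi, ?_⟩
      simp only [bad, Finset.mem_filter, Finset.mem_univ, true_and]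
      exact fun h => hW (h hi)
  -- Union bound over at most `N` files, each failing with probability at most `1/(2N)`. The
  -- surviving half of the libraries costs the one extra bit.
  have hhalf : Fintype.card (Files N F) ≤ 2 * good.card := by
    have h1 : Fintype.card (Files N F) ≤ good.card + ∑ i ∈ A, (bad i).card :=
      (Finset.card_le_card hcover).trans
        ((Finset.card_union_le _ _).trans (Nat.add_le_add_left Finset.card_biUnion_le _))
    have h2 : ∑ i ∈ A, ((bad i).card : ℝ) ≤ Fintype.card (Files N F) / 2 := by
      refine (Finset.sum_le_sum hbad).trans ?_
      rw [Finset.sum_const, nsmul_eq_mul]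
      have hAN : (A.card : ℝ) ≤ N := by
        exact_mod_cast (Finset.card_le_univ A).trans (Fintype.card_fin N).le
      rcases Nat.eq_zero_or_pos N with h0 | h0
      · have : (A.card : ℝ) ≤ 0 := by simpa [h0] using hAN
        have : (A.card : ℝ) = 0 := le_antisymm this (Nat.cast_nonneg _)
        rw [this, zero_mul]; positivity
      · have h0' : (0 : ℝ) < N := by exact_mod_cast h0
        calc _ ≤ (N : ℝ) * (Fintype.card (Files N F) / (2 * N)) := by gcongr
          _ = _ := by field_simp
    have h3 : (Fintype.card (Files N F) : ℝ) ≤ good.card + ∑ i ∈ A, ((bad i).card : ℝ) := by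
      exact_mod_cast h1
    have h4 : (Fintype.card (Files N F) : ℝ) ≤ 2 * good.card := by linarith
    exact_mod_cast h4
  -- On `good`, the messages, the caches of `T` and the files outside `A` determine the whole
  -- library.
  let φ (W : Files N F) : ((i : ι) → Fin (S.len (d i)) → Bool) × (T → Fin C → Bool) ×
      ({i // i ∉ A} → Fin F → Bool) :=
    (fun i => S.encode (d i) W, fun k => S.cache k W, fun i => W i)
  have hinj : Set.InjOn φ (good : Set (Files N F)) := by
    intro W hW W' hW' h
    simp only [good, Finset.coe_filter, Finset.mem_univ, true_and, Set.mem_ofPred_eq] at hW hW'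
    simp only [φ, Prod.mk.injEq] at h
    obtain ⟨he, hc, ho⟩ := h
    funext i
    by_cases hi : i ∈ A
    · rw [← hW i hi, ← hW' i hi, congrFun he (j i)]
      rw [show S.cache (t i) W = S.cache (t i) W' from congrFun hc ⟨t i, htT i hi⟩]
    · exact congrFun ho ⟨i, hi⟩
  have hcard : good.card ≤ 2 ^ (∑ i, S.len (d i) + T.card * C + (N - A.card) * F) := by
    have h := Finset.card_le_card_of_injOn (t := Finset.univ) φ (fun _ _ => Finset.mem_univ _) hinj
    refine h.trans (le_of_eq ?_)
    simp only [Finset.card_univ, Fintype.card_prod, Fintype.card_pi, Fintype.card_fin,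
      Fintype.card_bool, Finset.prod_const, Fintype.card_coe, Fintype.card_subtype_compl,
      Finset.prod_pow_eq_pow_sum]
    rw [← pow_mul, ← pow_mul, ← pow_add, ← pow_add, mul_comm C, mul_comm F, add_assoc]
  have hall : Fintype.card (Files N F) = 2 ^ (N * F) := by
    simp [Fintype.card_pi, ← pow_mul, mul_comm]
  rw [hall] at hhalf
  have hpow : 2 ^ (N * F) ≤ 2 ^ (∑ i, S.len (d i) + T.card * C + (N - A.card) * F + 1) := by
    rw [pow_succ]; omega
  have hexp := (Nat.pow_le_pow_iff_right (by norm_num : 1 < 2)).1 hpow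
  have hAN : A.card ≤ N := (Finset.card_le_univ A).trans (Fintype.card_fin N).le
  have hsplit : N * F = A.card * F + (N - A.card) * F := by
    rw [← Nat.add_mul, Nat.add_sub_cancel' hAN]
  omega

/-! ### Averaging over independent rounds -/

/-- Averaging a covering inequality over independent choices `x 0, …, x (b - 1)` with
distribution `w`. -/
theorem mul_sum_one_sub_pow_le {Ω κ : Type*} [Fintype Ω] [DecidableEq κ] (w : Ω → ℝ)
    (hw : ∀ x, 0 ≤ w x) (hw1 : ∑ x, w x = 1) (len : Ω → ℝ) (G : Finset κ) (hit : κ → Ω → Prop)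
    [∀ i, DecidablePred (hit i)] (b : ℕ) (F c : ℝ)
    (h : ∀ x : Fin b → Ω,
      F * (G.filter fun i => ∃ j, hit i (x j)).card ≤ ∑ j, len (x j) + c) :
    F * ∑ i ∈ G, (1 - (∑ x with ¬ hit i x, w x) ^ b) ≤ b * ∑ x, w x * len x + c := by
  classical
  have hprod (f : Fin b → Ω → ℝ) : ∑ x : Fin b → Ω, ∏ j, f j (x j) = ∏ j, ∑ y, f j y := by
    rw [Finset.prod_univ_sum, Fintype.piFinset_univ]
  have hone : ∑ x : Fin b → Ω, ∏ j, w (x j) = 1 := by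
    rw [hprod fun _ => w]; simp [hw1]
  have hlen (j : Fin b) : ∑ x : Fin b → Ω, (∏ j, w (x j)) * len (x j) = ∑ y, w y * len y := by
    -- Attaching `len` to the factor of index `j` alone makes the sum factor over coordinates.
    have h1 : ∀ x : Fin b → Ω, (∏ j, w (x j)) * len (x j) =
        ∏ j', (w (x j') * if j' = j then len (x j') else 1) := by
      intro x
      rw [Finset.prod_mul_distrib]
      simp
    simp_rw [h1]
    rw [hprod fun j' y => w y * if j' = j then len y else 1]
    rw [Finset.prod_eq_single j]
    · simp
    · intro j' _ hj'
      simp [hj', hw1]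
    · simp
  have hmiss (i : κ) : ∑ x : Fin b → Ω, (∏ j, w (x j)) * (if ∃ j, hit i (x j) then 1 else 0) =
      1 - (∑ x with ¬ hit i x, w x) ^ b := by
    have h1 : ∀ x : Fin b → Ω, (∏ j, w (x j)) * (if ∃ j, hit i (x j) then (1 : ℝ) else 0) =
        ∏ j, w (x j) - ∏ j, (if ¬ hit i (x j) then w (x j) else 0) := by
      intro x
      by_cases hx : ∃ j, hit i (x j)
      · obtain ⟨j, hj⟩ := hx
        rw [if_pos ⟨j, hj⟩, mul_one, Finset.prod_eq_zero (i := j)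
          (f := fun j => if ¬ hit i (x j) then w (x j) else 0) (Finset.mem_univ _) (by simp [hj]),
          sub_zero]
      · rw [if_neg hx]
        push Not at hx
        simp [hx]
    simp_rw [h1]
    rw [Finset.sum_sub_distrib, hone, hprod fun _ y => if ¬ hit i y then w y else 0]
    simp [Finset.sum_filter]
  calc F * ∑ i ∈ G, (1 - (∑ x with ¬ hit i x, w x) ^ b)
      = ∑ x : Fin b → Ω, (∏ j, w (x j)) * (F * (G.filter fun i => ∃ j, hit i (x j)).card) := by
        simp_rw [← hmiss]
        rw [Finset.sum_comm, Finset.mul_sum]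
        refine Finset.sum_congr rfl fun x _ => ?_
        rw [← Finset.mul_sum, Finset.sum_boole]
        ring
    _ ≤ ∑ x : Fin b → Ω, (∏ j, w (x j)) * (∑ j, len (x j) + c) :=
        Finset.sum_le_sum fun x _ =>
          mul_le_mul_of_nonneg_left (h x) (Finset.prod_nonneg fun j _ => hw _)
    _ = b * ∑ x, w x * len x + c := by
        simp_rw [mul_add, Finset.mul_sum]
        rw [Finset.sum_add_distrib, ← Finset.sum_mul, hone, Finset.sum_comm]
        simp_rw [hlen]
        simp [Finset.mul_sum]

/-! ### Conditioning on the users who request in a group -/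

/-- The request vectors for which exactly the users in `U` request a file in `G`. -/
def requestsIn {N : ℕ} (K : ℕ) (G : Finset (Fin N)) (U : Finset (Fin K)) :
    Finset (Demand N K) :=
  Fintype.piFinset fun k => if k ∈ U then G else Gᶜ

theorem mem_requestsIn {N K : ℕ} {G : Finset (Fin N)} {U : Finset (Fin K)} {d : Demand N K} :
    d ∈ requestsIn K G U ↔ (Finset.univ.filter fun k => d k ∈ G) = U := by
  simp only [requestsIn, Fintype.mem_piFinset, Finset.ext_iff, Finset.mem_filter,
    Finset.mem_univ, true_and]
  refine forall_congr' fun k => ?_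
  by_cases hk : k ∈ U <;> simp [hk]

theorem sum_requestsIn {N K : ℕ} (G : Finset (Fin N)) (f : Demand N K → ℝ) :
    ∑ U : Finset (Fin K), ∑ d ∈ requestsIn K G U, f d = ∑ d, f d := by
  rw [← Finset.sum_fiberwise (s := Finset.univ) (g := fun d : Demand N K =>
    Finset.univ.filter fun k => d k ∈ G)]
  refine Finset.sum_congr rfl fun U _ => Finset.sum_congr ?_ fun _ _ => rfl
  ext d
  simp [mem_requestsIn]

/-- Given that exactly the users in `U` request files in `G`, the users in `T ⊆ U` all avoid the
file `i` independently of each other. -/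
theorem sum_requestsIn_avoid {N K : ℕ} (p : Fin N → ℝ) {G : Finset (Fin N)}
    (hG : ∑ i ∈ G, p i ≠ 0) {T U : Finset (Fin K)} (hTU : T ⊆ U) {i : Fin N} (hi : i ∈ G) :
    ∑ d ∈ requestsIn K G U with ¬ ∃ t ∈ T, d t = i, ∏ k, p (d k) =
      (∑ d ∈ requestsIn K G U, ∏ k, p (d k)) * (1 - p i / ∑ i ∈ G, p i) ^ T.card := by
  classical
  -- The event is again a product set, so its weight is a product over users.
  have h1 : (requestsIn K G U).filter (fun d => ¬ ∃ t ∈ T, d t = i) =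
      Fintype.piFinset fun k => if k ∈ T then G.erase i else if k ∈ U then G else Gᶜ := by
    ext d
    simp only [requestsIn, Finset.mem_filter, Fintype.mem_piFinset, not_exists, not_and]
    rw [← forall_and]
    refine forall_congr' fun k => ?_
    by_cases hk : k ∈ T
    · simp [hk, hTU hk, and_comm]
    · simp [hk]
  rw [h1, requestsIn, ← Finset.prod_univ_sum, ← Finset.prod_univ_sum]
  have h2 : (1 - p i / ∑ i ∈ G, p i) ^ T.card =
      ∏ k : Fin K, if k ∈ T then (1 - p i / ∑ i ∈ G, p i) else 1 := by
    simp [Finset.prod_ite_mem]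
  rw [h2, ← Finset.prod_mul_distrib]
  refine Finset.prod_congr rfl fun k _ => ?_
  by_cases hk : k ∈ T
  · simp only [hk, hTU hk, if_true]
    rw [← Finset.sum_erase_add _ _ hi]
    rw [← Finset.sum_erase_add _ _ hi] at hG
    field_simp
    ring
  · simp [hk]

theorem sum_requestsIn_eq {N K : ℕ} (p : Fin N → ℝ) {G : Finset (Fin N)}
    (hG : ∑ i ∈ G, p i ≠ 0) {t : Fin K} {U : Finset (Fin K)} (ht : t ∈ U) {i : Fin N}
    (hi : i ∈ G) :
    ∑ d ∈ requestsIn K G U with d t = i, ∏ k, p (d k) =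
      (∑ d ∈ requestsIn K G U, ∏ k, p (d k)) * (p i / ∑ i ∈ G, p i) := by
  have h := sum_requestsIn_avoid p hG (Finset.singleton_subset_iff.2 ht) hi
  simp only [Finset.mem_singleton, exists_eq_left, Finset.card_singleton, pow_one] at h
  have h2 := Finset.sum_filter_add_sum_filter_not (requestsIn K G U) (fun d => d t = i)
    (fun d => ∏ k, p (d k))
  rw [h] at h2
  linarith

/-! ### Upper bounds on the peak rate -/

theorem peakRate_zero_users (M : ℝ) (n : ℕ) : peakRate M n 0 = 0 := by
  simp [peakRate]

theorem peakRate_of_lt {M : ℝ} {n k : ℕ} (h : (n : ℝ) < M) : peakRate M n k = 0 := by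
  have h0 : M ≠ 0 := fun h0 => by
    rw [h0] at h
    exact absurd h (not_lt.2 (Nat.cast_nonneg n))
  simp [peakRate, h0, not_le.2 h]

theorem peakRate_le_users {M : ℝ} (hM : 0 ≤ M) {n k : ℕ} (hn : 0 < n) (hk : 0 < k)
    (h : M ≤ n) : peakRate M n k ≤ k := by
  have hn' : (0 : ℝ) < n := by exact_mod_cast hn
  have hk' : (0 : ℝ) < k := by exact_mod_cast hk
  unfold peakRate
  split_ifs with h0
  · exact min_le_right _ _
  · have hM' : 0 < M := lt_of_le_of_ne hM (Ne.symm h0)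
    have hx1 : M / n ≤ 1 := (div_le_one hn').2 h
    have hx0 : 0 < M / n := by positivity
    -- Bernoulli's inequality at `-M/n`.
    have hb : 1 - (1 - M / n) ^ k ≤ k * (M / n) := by
      have := one_add_mul_le_pow (a := -(M / n)) (by linarith) k
      rw [← sub_eq_add_neg] at this
      linarith
    have h1 : (n : ℝ) / (k * M) * (1 - (1 - M / n) ^ k) ≤ 1 := by
      calc _ ≤ (n : ℝ) / (k * M) * (k * (M / n)) := by gcongr
        _ = 1 := by field_simp
    calc _ ≤ (k : ℝ) * (1 - M / n) * 1 := by
          refine mul_le_mul_of_nonneg_left ((min_le_left _ _).trans h1) ?_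
          exact mul_nonneg hk'.le (by linarith)
      _ ≤ k * 1 * 1 := by gcongr; linarith
      _ = k := by ring

theorem peakRate_le_files {M : ℝ} (hM : 0 ≤ M) {n k : ℕ} (hn : 0 < n) (hk : 0 < k)
    (h : M ≤ n) : peakRate M n k ≤ n := by
  have hn' : (0 : ℝ) < n := by exact_mod_cast hn
  have hk' : (0 : ℝ) < k := by exact_mod_cast hk
  unfold peakRate
  split_ifs with h0
  · exact min_le_left _ _
  · have hx1 : M / n ≤ 1 := (div_le_one hn').2 h
    have hx0 : 0 ≤ M / n := by positivity
    calc _ ≤ (k : ℝ) * (1 - M / n) * (n / k) :=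
          mul_le_mul_of_nonneg_left (min_le_right _ _) (mul_nonneg hk'.le (by linarith))
      _ ≤ k * 1 * (n / k) := by gcongr; linarith
      _ = n := by field_simp

/-- Keeps the factor `1 - M/n`, which the single-user bound needs when `M` is close to `n`. -/
theorem peakRate_le_div_mul {M : ℝ} (hM : 0 < M) {n k : ℕ} (hn : 0 < n) (hk : 0 < k)
    (h : M ≤ n) : peakRate M n k ≤ n / M * (1 - M / n) := by
  have hn' : (0 : ℝ) < n := by exact_mod_cast hn
  have hk' : (0 : ℝ) < k := by exact_mod_cast hk
  have hx1 : M / n ≤ 1 := (div_le_one hn').2 h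
  rw [peakRate, if_neg hM.ne', if_pos h]
  have h1 : (n : ℝ) / (k * M) * (1 - (1 - M / n) ^ k) ≤ n / (k * M) * 1 := by
    gcongr
    have := pow_nonneg (sub_nonneg.2 hx1) k
    linarith
  calc _ ≤ (k : ℝ) * (1 - M / n) * (n / (k * M) * 1) :=
        mul_le_mul_of_nonneg_left ((min_le_left _ _).trans h1) (mul_nonneg hk'.le (by linarith))
    _ = _ := by field_simp

/-- A number `s` of users whose caches together hold at most a sixth of the files, and which is
of the order of the peak rate. -/
theorem exists_users_of_le {M : ℝ} (hM : 0 ≤ M) {n k : ℕ} (hn : 0 < n) (hk : 0 < k)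
    (h : 6 * M ≤ n) :
    ∃ s : ℕ, 0 < s ∧ s ≤ k ∧ s ≤ n ∧ 6 * (s * M) ≤ n ∧ peakRate M n k ≤ 12 * s := by
  have hn' : (0 : ℝ) < n := by exact_mod_cast hn
  have hMn : M ≤ n := by linarith
  have hk1 := peakRate_le_users hM hn hk hMn
  have hn1 := peakRate_le_files hM hn hk hMn
  rcases hM.eq_or_lt with h0 | h0
  · subst h0
    refine ⟨min k n, lt_min hk hn, min_le_left _ _, min_le_right _ _, by simp, ?_⟩
    have : peakRate 0 n k ≤ ((min k n : ℕ) : ℝ) := by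
      rw [Nat.cast_min]; exact le_min hk1 hn1
    have h0 : (0 : ℝ) ≤ ((min k n : ℕ) : ℝ) := Nat.cast_nonneg _
    linarith
  · have h1 : (1 : ℝ) ≤ n / (6 * M) := by rw [le_div_iff₀ (by positivity)]; linarith
    set q := ⌊(n : ℝ) / (6 * M)⌋₊ with hq
    have hq1 : 1 ≤ q := Nat.le_floor (by exact_mod_cast h1)
    have hqle : (q : ℝ) ≤ n / (6 * M) := Nat.floor_le (by positivity)
    have hqlt : (n : ℝ) / (6 * M) < q + 1 := Nat.lt_floor_add_one _
    have hq1' : (1 : ℝ) ≤ q := by exact_mod_cast hq1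
    refine ⟨min (min k n) q, lt_min (lt_min hk hn) hq1, (min_le_left _ _).trans (min_le_left _ _),
      (min_le_left _ _).trans (min_le_right _ _), ?_, ?_⟩
    · have : ((min (min k n) q : ℕ) : ℝ) ≤ n / (6 * M) :=
        (Nat.cast_le.2 (min_le_right _ _)).trans hqle
      rw [le_div_iff₀ (by positivity)] at this
      linarith
    -- Rounding costs a factor two: `n/(6M) < q + 1 ≤ 2q`, hence `12 = 6 · 2`.
    · have h2 : peakRate M n k ≤ 12 * q := by
        have h3 := peakRate_le_div_mul h0 hn hk hMn
        have h4 : (n : ℝ) / M * (1 - M / n) ≤ n / M * 1 := by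
          gcongr
          have : 0 < M / n := by positivity
          linarith
        have h5 : (n : ℝ) / (6 * M) = n / M / 6 := by field_simp
        rw [h5] at hqlt
        linarith
      have h6 : peakRate M n k / 12 ≤ ((min (min k n) q : ℕ) : ℝ) := by
        rw [Nat.cast_min, Nat.cast_min]
        have hk0 : (0 : ℝ) ≤ k := Nat.cast_nonneg _
        refine le_min (le_min ?_ ?_) ?_ <;> linarith
      linarith

/-- Since `(1 - x)(1 + x) ≤ 1`, it suffices that `(1 + x)^n ≥ 1 + nx ≥ 3/2`. This bounds the
probability that a file of conditional popularity `x` is missed in `m` draws. -/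
theorem one_sub_pow_le_two_thirds {n m : ℕ} (hn : 0 < n) (hm : n ≤ m) {x : ℝ}
    (hx : 1 / (2 * n) ≤ x) (hx1 : x ≤ 1) : (1 - x) ^ m ≤ 2 / 3 := by
  have hn' : (0 : ℝ) < n := by exact_mod_cast hn
  have hx0 : 0 ≤ x := le_trans (by positivity) hx
  have h1 : (1 - x) ^ m ≤ (1 - x) ^ n := pow_le_pow_of_le_one (by linarith) (by linarith) hm
  have h2 : 3 / 2 ≤ (1 + x) ^ n := by
    have h3 := one_add_mul_le_pow (a := x) (by linarith) n
    have h4 : (1 : ℝ) / 2 ≤ n * x := by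
      rw [div_le_iff₀ (by positivity)] at hx
      linarith
    linarith
  have h5 : (1 - x) ^ n * (1 + x) ^ n ≤ 1 := by
    rw [← mul_pow]
    exact pow_le_one₀ (mul_nonneg (by linarith) (by linarith)) (by nlinarith)
  have h6 : 0 ≤ (1 - x) ^ n := pow_nonneg (by linarith) _
  nlinarith

/-! ### Conditional lower bounds for one group -/

section Group

variable {N K F C : ℕ} {p : Fin N → ℝ} {G : Finset (Fin N)} {M : ℝ}

/-- Expected length of the transmission when a single user requests each of the files in turn. -/
theorem Scheme.sum_len_ge_of_single (S : Scheme N K F C)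
    (hS : ∀ d k, S.errorProb d k ≤ 1 / (2 * (N : ℝ))) (hp : ∀ n, 0 < p n) (hG : G.Nonempty)
    (hpG : ∀ i ∈ G, ∑ i ∈ G, p i ≤ 2 * G.card * p i) {U : Finset (Fin K)} {t : Fin K}
    (ht : t ∈ U) (hC : (C : ℝ) ≤ M * F) :
    (∑ d ∈ requestsIn K G U, ∏ k, p (d k)) * ((1 - M / G.card) / 2 * F - 1) ≤
      ∑ d ∈ requestsIn K G U, (∏ k, p (d k)) * S.len d := by
  classical
  have hcard : (0 : ℝ) < G.card := by exact_mod_cast hG.card_pos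
  have hcard1 : (1 : ℝ) ≤ G.card := by exact_mod_cast hG.card_pos
  have hP : 0 < ∑ i ∈ G, p i := Finset.sum_pos (fun i _ => hp i) hG
  have hw : ∀ d : Demand N K, 0 ≤ ∏ k, p (d k) := fun d => Finset.prod_nonneg fun k _ => (hp _).le
  rcases (requestsIn K G U).eq_empty_or_nonempty with hQ | ⟨d₀, hd₀⟩
  · simp [hQ]
  -- The shortest transmission with `d t = i` bounds the average over that class from below. The
  -- class is nonempty: resetting the request of `t ∈ U` to `i ∈ G` leaves `U` unchanged.
  have hshort : ∀ i ∈ G, ∃ d ∈ (requestsIn K G U).filter (fun d => d t = i),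
      ∀ d' ∈ (requestsIn K G U).filter (fun d => d t = i), S.len d ≤ S.len d' := by
    intro i hi
    refine Finset.exists_min_image _ _ ⟨Function.update d₀ t i, ?_⟩
    rw [requestsIn, Fintype.mem_piFinset] at hd₀
    simp only [requestsIn, Finset.mem_filter, Fintype.mem_piFinset, Function.update_self, and_true]
    intro k
    by_cases hk : k = t
    · subst hk; simp [ht, hi]
    · simpa [hk] using hd₀ k
  choose! e he hmin using hshort
  have hcount := S.card_mul_le hS (fun i : G => e i) {t} G (fun i hi =>
    ⟨⟨i, hi⟩, t, Finset.mem_singleton_self t, (Finset.mem_filter.1 (he i hi)).2⟩)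
  rw [Finset.sum_coe_sort G (fun i => S.len (e i)), Finset.card_singleton, one_mul] at hcount
  have hcount' : (G.card : ℝ) * F ≤ ∑ i ∈ G, (S.len (e i) : ℝ) + C + 1 := by exact_mod_cast hcount
  set Q := ∑ d ∈ requestsIn K G U, ∏ k, p (d k) with hQdef
  have hQ0 : 0 ≤ Q := Finset.sum_nonneg fun d _ => hw d
  have hfib : ∑ d ∈ requestsIn K G U, (∏ k, p (d k)) * (S.len d : ℝ) =
      ∑ i ∈ G, ∑ d ∈ requestsIn K G U with d t = i, (∏ k, p (d k)) * (S.len d : ℝ) := by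
    refine (Finset.sum_fiberwise_of_maps_to (fun d hd => ?_) _).symm
    have := Fintype.mem_piFinset.1 hd t
    simpa [ht] using this
  rw [hfib]
  have hterm : ∀ i ∈ G, Q * (1 / (2 * G.card)) * (S.len (e i) : ℝ) ≤
      ∑ d ∈ requestsIn K G U with d t = i, (∏ k, p (d k)) * (S.len d : ℝ) := by
    intro i hi
    calc Q * (1 / (2 * G.card)) * (S.len (e i) : ℝ)
        ≤ Q * (p i / ∑ i ∈ G, p i) * (S.len (e i) : ℝ) := by
          have : 1 / (2 * (G.card : ℝ)) ≤ p i / ∑ i ∈ G, p i := by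
            rw [div_le_div_iff₀ (by positivity) hP]
            linarith [hpG i hi]
          gcongr
      _ = ∑ d ∈ requestsIn K G U with d t = i, (∏ k, p (d k)) * (S.len (e i) : ℝ) := by
          rw [← sum_requestsIn_eq p hP.ne' ht hi, Finset.sum_mul]
      _ ≤ _ := Finset.sum_le_sum fun d hd =>
          mul_le_mul_of_nonneg_left (Nat.cast_le.2 (hmin i hi d hd)) (hw d)
  refine le_trans ?_ (Finset.sum_le_sum hterm)
  rw [← Finset.mul_sum, mul_assoc]
  refine mul_le_mul_of_nonneg_left ?_ hQ0
  rw [one_div_mul_eq_div, le_div_iff₀ (by positivity)]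
  have : ((1 - M / G.card) / 2 * F - 1) * (2 * G.card) = G.card * F - M * F - 2 * G.card := by
    field_simp
  rw [this]
  linarith

/-- Expected length of the transmission, from independent rounds of requests of the users in `T`. -/
theorem Scheme.sum_len_ge_of_rounds (S : Scheme N K F C)
    (hS : ∀ d k, S.errorProb d k ≤ 1 / (2 * (N : ℝ))) (hp : ∀ n, 0 < p n) (hG : G.Nonempty)
    (hpG : ∀ i ∈ G, ∑ i ∈ G, p i ≤ 2 * G.card * p i) {U T : Finset (Fin K)} (hTU : T ⊆ U)
    (hT : T.Nonempty) (hTG : T.card ≤ G.card) (hC : (C : ℝ) ≤ M * F)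
    (hM : 6 * (T.card * M) ≤ G.card) :
    (∑ d ∈ requestsIn K G U, ∏ k, p (d k)) * ((T.card : ℝ) / 12 * F - 1) ≤
      ∑ d ∈ requestsIn K G U, (∏ k, p (d k)) * S.len d := by
  classical
  have hn : (0 : ℝ) < G.card := by exact_mod_cast hG.card_pos
  have hs : (0 : ℝ) < T.card := by exact_mod_cast hT.card_pos
  have hP : 0 < ∑ i ∈ G, p i := Finset.sum_pos (fun i _ => hp i) hG
  have hw : ∀ d : Demand N K, 0 < ∏ k, p (d k) := fun d => Finset.prod_pos fun k _ => hp _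
  rcases (requestsIn K G U).eq_empty_or_nonempty with hQ | hQ
  · simp [hQ]
  set Q := ∑ d ∈ requestsIn K G U, ∏ k, p (d k) with hQdef
  have hQ0 : 0 < Q := Finset.sum_pos (fun d _ => hw d) hQ
  -- The conditional law of the requests given `U`.
  let w (d : Demand N K) : ℝ := if d ∈ requestsIn K G U then (∏ k, p (d k)) / Q else 0
  have hsumw (f : Demand N K → ℝ) : ∑ d, w d * f d =
      (∑ d ∈ requestsIn K G U, (∏ k, p (d k)) * f d) / Q := by
    simp only [w, ite_mul, zero_mul]
    rw [Finset.sum_ite_mem, Finset.univ_inter, Finset.sum_div]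
    exact Finset.sum_congr rfl fun d _ => by ring
  have hw1 : ∑ d, w d = 1 := by
    have := hsumw fun _ => 1
    simp only [mul_one] at this
    rw [this, ← hQdef, div_self hQ0.ne']
  have hw0 : ∀ d, 0 ≤ w d := fun d => by
    simp only [w]; split_ifs
    · exact div_nonneg (hw d).le hQ0.le
    · exact le_rfl
  let hit (i : Fin N) (d : Demand N K) : Prop := ∃ t ∈ T, d t = i
  have hmiss : ∀ i ∈ G, ∑ d with ¬ hit i d, w d = (1 - p i / ∑ i ∈ G, p i) ^ T.card := by
    intro i hi
    have h1 := sum_requestsIn_avoid p hP.ne' hTU hi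
    have h2 := hsumw fun d => if ¬ hit i d then 1 else 0
    simp only [mul_ite, mul_one, mul_zero] at h2
    rw [Finset.sum_filter, h2, ← Finset.sum_filter, h1, mul_div_assoc, mul_comm, ← hQdef]
    field_simp
  -- Enough rounds for `n` draws in all; at most `2n` because `T.card ≤ G.card`.
  obtain ⟨b, hbn, hbs⟩ : ∃ b : ℕ, G.card ≤ T.card * b ∧ T.card * b ≤ 2 * G.card := by
    refine ⟨G.card / T.card + 1, ?_, ?_⟩
    · exact (Nat.lt_mul_div_succ _ hT.card_pos).le
    · rw [mul_add, mul_one]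
      have := Nat.mul_div_le G.card T.card
      omega
  have hb0 : 0 < b := by
    rcases Nat.eq_zero_or_pos b with h | h
    · rw [h, mul_zero] at hbn
      exact absurd hG.card_pos (by omega)
    · exact h
  have hb1 : (1 : ℝ) ≤ b := by exact_mod_cast hb0
  have key := mul_sum_one_sub_pow_le w hw0 hw1 (fun d => (S.len d : ℝ)) G hit b F
    (T.card * C + 1) (fun x => by
      have := S.card_mul_le hS x T (G.filter fun i => ∃ j, hit i (x j))
        (fun i hi => (Finset.mem_filter.1 hi).2)
      have h' : ((G.filter fun i => ∃ j, hit i (x j)).card : ℝ) * F ≤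
          ∑ j, (S.len (x j) : ℝ) + T.card * C + 1 := by exact_mod_cast this
      linarith)
  rw [hsumw] at key
  have hdist : (G.card : ℝ) / 3 ≤ ∑ i ∈ G, (1 - (∑ d with ¬ hit i d, w d) ^ b) := by
    have : ∀ i ∈ G, (1 : ℝ) / 3 ≤ 1 - (∑ d with ¬ hit i d, w d) ^ b := by
      intro i hi
      rw [hmiss i hi, ← pow_mul]
      have h1 : 1 / (2 * (G.card : ℝ)) ≤ p i / ∑ i ∈ G, p i := by
        rw [div_le_div_iff₀ (by positivity) hP]
        linarith [hpG i hi]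
      have h2 : p i / ∑ i ∈ G, p i ≤ 1 := by
        rw [div_le_one hP]
        exact Finset.single_le_sum (fun i _ => (hp i).le) hi
      linarith [one_sub_pow_le_two_thirds hG.card_pos hbn h1 h2]
    calc (G.card : ℝ) / 3 = ∑ i ∈ G, (1 : ℝ) / 3 := by
          rw [Finset.sum_const, nsmul_eq_mul]; ring
      _ ≤ _ := Finset.sum_le_sum this
  set E := (∑ d ∈ requestsIn K G U, (∏ k, p (d k)) * (S.len d : ℝ)) / Q with hE
  rw [mul_comm, ← le_div_iff₀ hQ0, ← hE]
  have hF : (0 : ℝ) ≤ F := Nat.cast_nonneg _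
  have h1 : (F : ℝ) * (G.card / 3) ≤ b * E + (T.card * C + 1) :=
    (mul_le_mul_of_nonneg_left hdist hF).trans key
  have h2 : (T.card : ℝ) * C ≤ G.card / 6 * F := by
    calc (T.card : ℝ) * C ≤ T.card * (M * F) := by gcongr
      _ = (T.card * M) * F := by ring
      _ ≤ G.card / 6 * F := by gcongr; linarith
  have h3 : (T.card : ℝ) * b ≤ 2 * G.card := by exact_mod_cast hbs
  have h4 : (T.card : ℝ) * b * F ≤ 2 * G.card * F := by gcongr
  refine le_of_mul_le_mul_left ?_ (lt_of_lt_of_le one_pos hb1)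
  -- Requested files minus caches leave `n/3 - n/6 = n/6` files, and `n/6 ≥ T.card * b / 12`; `b ≥
  -- 1` absorbs the extra bit.
  nlinarith

end Group

/-- The constant `144 = 12 · 12` comes from the rounds, needed for `6M ≤ n`; for larger `M` the
single-user bound would already give `12`. -/
theorem Scheme.sum_len_ge_peakRate {N K F C : ℕ} {p : Fin N → ℝ} {G : Finset (Fin N)} {M : ℝ}
    (S : Scheme N K F C) (hS : ∀ d k, S.errorProb d k ≤ 1 / (2 * (N : ℝ))) (hp : ∀ n, 0 < p n)
    (hG : G.Nonempty) (hpG : ∀ i ∈ G, ∑ i ∈ G, p i ≤ 2 * G.card * p i) (U : Finset (Fin K))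
    (hM : 0 ≤ M) (hC : (C : ℝ) ≤ M * F) :
    (∑ d ∈ requestsIn K G U, ∏ k, p (d k)) * (peakRate M G.card U.card / 144 * F - 1) ≤
      ∑ d ∈ requestsIn K G U, (∏ k, p (d k)) * S.len d := by
  have hn : (0 : ℝ) < G.card := by exact_mod_cast hG.card_pos
  have hw : ∀ d : Demand N K, 0 ≤ ∏ k, p (d k) := fun d => Finset.prod_nonneg fun k _ => (hp _).le
  have hQ : 0 ≤ ∑ d ∈ requestsIn K G U, ∏ k, p (d k) := Finset.sum_nonneg fun d _ => hw d
  have hF : (0 : ℝ) ≤ F := Nat.cast_nonneg _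
  have htriv (h0 : peakRate M G.card U.card = 0) :
      (∑ d ∈ requestsIn K G U, ∏ k, p (d k)) * (peakRate M G.card U.card / 144 * F - 1) ≤
        ∑ d ∈ requestsIn K G U, (∏ k, p (d k)) * S.len d := by
    have h1 : 0 ≤ ∑ d ∈ requestsIn K G U, (∏ k, p (d k)) * (S.len d : ℝ) :=
      Finset.sum_nonneg fun d _ => mul_nonneg (hw d) (Nat.cast_nonneg _)
    rw [h0]
    linarith
  rcases U.eq_empty_or_nonempty with hU | hU
  · exact htriv (by rw [hU, Finset.card_empty, peakRate_zero_users])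
  rcases lt_or_ge (G.card : ℝ) M with hMG | hMG
  · exact htriv (peakRate_of_lt hMG)
  rcases le_or_gt (6 * M) G.card with h6 | h6
  · obtain ⟨s, hs0, hsU, hsG, hsM, hs⟩ := exists_users_of_le hM hG.card_pos hU.card_pos h6
    obtain ⟨T, hTU, rfl⟩ := Finset.exists_subset_card_eq hsU
    refine le_trans ?_
      (S.sum_len_ge_of_rounds hS hp hG hpG hTU (Finset.card_pos.1 hs0) hsG hC hsM)
    refine mul_le_mul_of_nonneg_left (sub_le_sub_right (mul_le_mul_of_nonneg_right ?_ hF) _) hQ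
    linarith
  · obtain ⟨t, ht⟩ := hU
    refine le_trans ?_ (S.sum_len_ge_of_single hS hp hG hpG ht hC)
    have hM0 : 0 < M := by linarith
    have h1 := peakRate_le_div_mul hM0 hG.card_pos (Finset.card_pos.2 ⟨t, ht⟩) hMG
    have h2 : (G.card : ℝ) / M ≤ 6 := by rw [div_le_iff₀ hM0]; linarith
    have h3 : 0 ≤ 1 - M / G.card := sub_nonneg.2 ((div_le_one hn).2 hMG)
    have h4 : (G.card : ℝ) / M * (1 - M / G.card) ≤ 6 * (1 - M / G.card) := by gcongr
    refine mul_le_mul_of_nonneg_left (sub_le_sub_right (mul_le_mul_of_nonneg_right ?_ hF) _) hQ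
    linarith

/-! ### From one group to the optimal rate -/

/-- Sending all the files achieves the rate `N`. -/
theorem isAchievable_natCast {N : ℕ} (p : Fin N → ℝ) (hp_sum : ∑ n, p n = 1) (K : ℕ)
    (M : ℝ) : IsAchievable p K M N := by
  intro ε hε
  filter_upwards [Filter.eventually_gt_atTop 0] with F hF
  have hF' : (0 : ℝ) < F := by exact_mod_cast hF
  refine ⟨⟨fun _ _ _ => false, fun _ => N * F, fun _ W x => W (finProdFinEquiv.symm x).1
    (finProdFinEquiv.symm x).2, fun d k m _ x => m (finProdFinEquiv (d k, x))⟩, ?_, ?_⟩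
  · intro d k
    simp only [Scheme.errorProb, Equiv.symm_apply_apply, ne_eq, not_true_eq_false,
      Finset.filter_false, Finset.card_empty, Nat.cast_zero, zero_div]
    exact hε.le
  · have hone : ∑ d : Demand N K, ∏ k, p (d k) = 1 := by
      have := Finset.prod_univ_sum (fun _ : Fin K => (Finset.univ : Finset (Fin N))) fun _ => p
      rw [Fintype.piFinset_univ] at this
      rw [← this]; simp [hp_sum]
    simp only [Scheme.expectedRate, expect]
    rw [← Finset.sum_mul, hone, one_mul]
    push_cast
    rw [mul_div_assoc, div_self hF'.ne', mul_one]

/-- The first file of the group is its most popular one, and at most twice as popular as file `i`.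
-/
theorem IsMaximalPartition.sum_le_mul {N L : ℕ} {p : Fin N → ℝ} (hp_anti : Antitone p)
    {g : Fin N → Fin L} (hg : IsMaximalPartition p g) {l : Fin L} {i : Fin N} (hi : g i = l) :
    ∑ n with g n = l, p n ≤ 2 * (Finset.univ.filter fun n => g n = l).card * p i := by
  have hne : (Finset.univ.filter fun n => g n = l).Nonempty := ⟨i, by simp [hi]⟩
  set m := (Finset.univ.filter fun n => g n = l).min' hne with hm
  have hgm : g m = l := (Finset.mem_filter.1 (Finset.min'_mem _ hne)).2
  have hfirst : ∀ n, g n = l → m ≤ n := fun n hn => Finset.min'_le _ _ (by simp [hn])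
  have hhalf : p m / 2 ≤ p i :=
    hg.half_le m i (fun n hn => hfirst n (hn.trans hgm)) (hi.trans hgm.symm)
  calc ∑ n with g n = l, p n ≤ ∑ n with g n = l, 2 * p i := by
        refine Finset.sum_le_sum fun n hn => ?_
        have := hp_anti (hfirst n (Finset.mem_filter.1 hn).2)
        linarith
    _ = _ := by rw [Finset.sum_const, nsmul_eq_mul]; ring

/-- Every achievable rate is, up to a constant, at least the expected peak rate for the users
requesting files in a single group. -/
theorem IsAchievable.expect_peakRate_le {N K L : ℕ} {p : Fin N → ℝ} (hp_pos : ∀ n, 0 < p n)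
    (hp_sum : ∑ n, p n = 1) (hp_anti : Antitone p) {g : Fin N → Fin L}
    (hg : IsMaximalPartition p g) {M R : ℝ} (hM : 0 ≤ M) (hR : IsAchievable p K M R) (l : Fin L) :
    expect p (fun d : Demand N K => peakRate M (groupSize g l) (groupUsers g l d)) ≤ 144 * R := by
  classical
  set A := expect p (fun d : Demand N K => peakRate M (groupSize g l) (groupUsers g l d)) with hA
  have hN : (0 : ℝ) < N := by
    rcases Nat.eq_zero_or_pos N with h | h
    · subst h; simp at hp_sum
    · exact_mod_cast h
  set G : Finset (Fin N) := Finset.univ.filter fun n => g n = l with hGdef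
  have hG : G.Nonempty := by
    obtain ⟨i, hi⟩ := hg.surjective l
    exact ⟨i, by simp [hGdef, hi]⟩
  have hpG : ∀ i ∈ G, ∑ i ∈ G, p i ≤ 2 * G.card * p i := fun i hi =>
    hg.sum_le_mul hp_anti (Finset.mem_filter.1 hi).2
  have hone : ∑ d : Demand N K, ∏ k, p (d k) = 1 := by
    have := Finset.prod_univ_sum (fun _ : Fin K => (Finset.univ : Finset (Fin N))) fun _ => p
    rw [Fintype.piFinset_univ] at this
    rw [← this]; simp [hp_sum]
  have hev : ∀ᶠ F : ℕ in Filter.atTop, A / 144 - 1 / (F : ℝ) ≤ R := by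
    -- One fixed error tolerance, independent of `F`, suffices.
    filter_upwards [hR (1 / (2 * (N : ℝ))) (by positivity), Filter.eventually_gt_atTop 0]
      with F ⟨S, hS, hSR⟩ hF
    have hF' : (0 : ℝ) < F := by exact_mod_cast hF
    refine le_trans ?_ hSR
    have hC : ((⌊M * (F : ℝ)⌋₊ : ℕ) : ℝ) ≤ M * F := Nat.floor_le (by positivity)
    have hsum := Finset.sum_le_sum fun U (_ : U ∈ (Finset.univ : Finset (Finset (Fin K)))) =>
      S.sum_len_ge_peakRate hS hp_pos hG hpG U hM hC
    rw [sum_requestsIn] at hsum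
    have hleft : ∑ U : Finset (Fin K), (∑ d ∈ requestsIn K G U, ∏ k, p (d k)) *
        (peakRate M G.card U.card / 144 * F - 1) = A / 144 * F - 1 := by
      have h1 : ∀ U : Finset (Fin K), (∑ d ∈ requestsIn K G U, ∏ k, p (d k)) *
          (peakRate M G.card U.card / 144 * F - 1) = ∑ d ∈ requestsIn K G U, (∏ k, p (d k)) *
          (peakRate M (groupSize g l) (groupUsers g l d) / 144 * F - 1) := by
        intro U
        rw [Finset.sum_mul]
        refine Finset.sum_congr rfl fun d hd => ?_
        rw [mem_requestsIn] at hd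
        have : groupUsers g l d = U.card := by
          rw [← hd, groupUsers]
          simp [hGdef]
        rw [this]
        rfl
      simp_rw [h1]
      rw [sum_requestsIn]
      simp_rw [mul_sub, mul_one]
      rw [Finset.sum_sub_distrib, hone, hA, expect, Finset.sum_div, Finset.sum_mul]
      congr 1
      exact Finset.sum_congr rfl fun d _ => by ring
    rw [hleft] at hsum
    have hrate : S.expectedRate p = (∑ d : Demand N K, (∏ k, p (d k)) * (S.len d : ℝ)) / F := by
      simp only [Scheme.expectedRate, expect, Finset.sum_div, mul_div_assoc]
    rw [hrate, le_div_iff₀ hF', sub_mul, one_div_mul_cancel hF'.ne']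
    exact hsum
  have hlim : Filter.Tendsto (fun F : ℕ => A / 144 - 1 / (F : ℝ)) Filter.atTop
      (nhds (A / 144 - 0)) :=
    tendsto_const_nhds.sub tendsto_one_div_atTop_nhds_zero_nat
  have := le_of_tendsto hlim hev
  linarith

end CodedCaching

theorem theorem2 {N K L : ℕ} (p : Fin N → ℝ) (hp_pos : ∀ n, 0 < p n) (hp_sum : ∑ n, p n = 1)
    (hp_anti : Antitone p) (g : Fin N → Fin L) (hg : CodedCaching.IsMaximalPartition p g)
    (M : ℝ) (hM : 0 ≤ M) :
    1 / ((72 * 12 : ℝ) * (L : ℝ)) *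
        ∑ l : Fin L, CodedCaching.expect p (fun d : CodedCaching.Demand N K =>
          CodedCaching.peakRate M (CodedCaching.groupSize g l) (CodedCaching.groupUsers g l d))
      ≤ CodedCaching.optimalRate M p K := by
  have hL : (0 : ℝ) < L := by
    have hN : 0 < N := by
      rcases Nat.eq_zero_or_pos N with h | h
      · subst h; simp at hp_sum
      · exact h
    exact_mod_cast Fin.pos (g ⟨0, hN⟩)
  -- An achievable rate must be exhibited, as the real `sInf` of the empty set is `0`.
  refine le_csInf ⟨N, CodedCaching.isAchievable_natCast p hp_sum K M⟩ fun R hR => ?_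
  -- Nonnegativity allows `144` to be relaxed to `72 * 12`.
  have hR0 : 0 ≤ R := by
    obtain ⟨F, S, -, hS⟩ := (hR 1 one_pos).exists
    refine le_trans (Finset.sum_nonneg fun d _ => ?_) hS
    exact mul_nonneg (Finset.prod_nonneg fun k _ => (hp_pos _).le) (by positivity)
  have hsum := Finset.sum_le_sum fun l (_ : l ∈ (Finset.univ : Finset (Fin L))) =>
    hR.expect_peakRate_le hp_pos hp_sum hp_anti hg hM l
  rw [Finset.sum_const, Finset.card_univ, Fintype.card_fin, nsmul_eq_mul] at hsum
  rw [one_div_mul_eq_div, div_le_iff₀ (by positivity)]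
  have : 0 ≤ R * L := by positivity
  linarith
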